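/- Let $d\ge 1$ be an integer, let $B_r=\{x\in\mathbb R^d:|x|<r\}$, and let $n$ be a real number with $n+d\notin\{2,4,6,\dots\}$ and $n\notin\{0,2,4,\dots\}$. Let $k\ge 0$ be an integer, and let $C^k(\bar B_1)$ be the space of real $k$-times continuously differentiable functions on $\bar B_1$, with norm equal to the sum of the maxima over $\bar B_1$ of the absolute values of all partial derivatives of order at most $k$. Let $C_0^\infty(B_4\setminus\bar B_3)$ be the set of real $C^\infty$ functions on $\mathbb R^d$ with compact support contained in $B_4\setminus\bar B_3$, and for such $g$ set $$K_ng(y)=\int_{\mathbb R^d}|x-y|^n g(x)\,dx .$$ Let $S$ be the set of functions on $B_1$ (extended to $\bar B_1$ by continuity) of the form $K_ng$ with $g\in C_0^\infty(B_4\setminus\bar B_3)$. Then $S\subset C^k(\bar B_1)$ and $S$ is everywhere dense in $C^k(\bar B_1)$: for every $f\in C^k(\bar B_1)$ and $\varepsilon>0$ there is $g\in C_0^\infty(B_4\setminus\bar B_3)$ with $\|f-K_ng\|_{C^k(\bar B_1)}<\varepsilon$. Moreover, if $-d<n<0$, then for every $g\in C_0^\infty(B_4\setminus\bar B_3)$ the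 integral defining $K_ng(y)$ converges absolutely for all $y\in\mathbb R^d$, $K_ng\in C^\infty(\mathbb R^d)$, and the derivatives of $K_ng$ of every order are bounded on $\mathbb R^d$ and tend to zero as $|y|\to\infty$. -/

import Mathlib

open MeasureTheory Metric Set Filter Topology
open scoped ContDiff

noncomputable section

/-- The Riesz-type kernel `K_n(x, y) = |x - y| ^ n` on `ℝ^d`, for a real exponent `n`. -/
def rieszKernel {d : ℕ} (n : ℝ) (x y : EuclideanSpace ℝ (Fin d)) : ℝ :=
  ‖x - y‖ ^ n

/-- The potential `K_n g (y) = ∫ |x - y| ^ n g(x) dx`. -/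
def rieszPotential {d : ℕ} (n : ℝ) (g : EuclideanSpace ℝ (Fin d) → ℝ)
    (y : EuclideanSpace ℝ (Fin d)) : ℝ :=
  ∫ x, rieszKernel n x y * g x

/-- `C_0^∞(U)`: smooth functions on `ℝ^d` whose support is compact and contained in `U`. -/
def IsTestFunctionOn {d : ℕ} (U : Set (EuclideanSpace ℝ (Fin d)))
    (g : EuclideanSpace ℝ (Fin d) → ℝ) : Prop :=
  ContDiff ℝ ∞ g ∧ HasCompactSupport g ∧ tsupport g ⊆ U

/-- The open shell `B_4 \ B̄_3`. -/
def shell (d : ℕ) : Set (EuclideanSpace ℝ (Fin d)) := ball 0 4 \ closedBall 0 3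

/-- `C^k(B̄_1)`: the functions that are `k` times continuously differentiable on the closed unit
ball (one-sided at the boundary). Only the values on the closed ball matter. -/
def CkClosedBall (d k : ℕ) : Set (EuclideanSpace ℝ (Fin d) → ℝ) :=
  {f | ContDiffOn ℝ k f (closedBall 0 1)}

/-- The partial derivative `∂_{ι 0} ⋯ ∂_{ι (j-1)} f (y)`, relative to the closed unit ball. -/
def partialDerivBall {d j : ℕ} (ι : Fin j → Fin d) (f : EuclideanSpace ℝ (Fin d) → ℝ)
    (y : EuclideanSpace ℝ (Fin d)) : ℝ :=
  iteratedFDerivWithin ℝ j f (closedBall 0 1) y (fun i => EuclideanSpace.single (ι i) (1 : ℝ))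

open Classical in
/-- The norm of `C^k(B̄_1)`: the sum of the maximal magnitudes of all partial derivatives of order
at most `k`. A derivative of order `j` is listed once, by the nondecreasing tuple
`ι 0 ≤ ⋯ ≤ ι (j-1)` of its directions (that is, by its multi-index). -/
def ckNorm (d k : ℕ) (f : EuclideanSpace ℝ (Fin d) → ℝ) : ℝ :=
  ∑ j ∈ Finset.range (k + 1), ∑ ι : Fin j → Fin d with Monotone ι,
    ⨆ y : closedBall (0 : EuclideanSpace ℝ (Fin d)) 1, |partialDerivBall ι f y|

/-- The set `S` of the functions that are represented on the unit ball (and, by continuity, on its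
closure) as `K_n g` with `g ∈ C_0^∞(B_4 \ B̄_3)`. -/
def shellPotentials (d : ℕ) (n : ℝ) : Set (EuclideanSpace ℝ (Fin d) → ℝ) :=
  {h | ∃ g, IsTestFunctionOn (shell d) g ∧ EqOn h (rieszPotential n g) (closedBall 0 1)}

/-- `A` is an everywhere dense subset of the normed space `C^k(B̄_1)`. -/
def IsDenseInCk (d k : ℕ) (A : Set (EuclideanSpace ℝ (Fin d) → ℝ)) : Prop :=
  A ⊆ CkClosedBall d k ∧
    ∀ f ∈ CkClosedBall d k, ∀ ε : ℝ, 0 < ε → ∃ h ∈ A, ckNorm d k (fun y => f y - h y) < ε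

end

/-!
Density of the potentials `K_n g` of shell densities in `C^k` of the closed unit ball `B`.

Everything happens at distances `2 ≤ |x - y| ≤ 5`, where the kernels are smooth. Integrating by
parts twice, `K_n (Δg) = n (n + d - 2) K_{n-2} g`, and the two exclusions on `n` say exactly that
none of the factors met on the way from `n` to `n - 2 j` vanishes. So every `K_{n-2j} g` is itself
a `K_n g'` on `B` (`exists_rieszPotential_eq_rieszPotential_sub`), and with it every potential with
kernel `|x - y|^n q(|x - y|⁻²)`, `q` a polynomial. By the one-variable Weierstrass theorem these
kernels approximate `|x - y|^(2 m)` uniformly. Since a potential is a convolution, its derivatives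
can be put on the density, so uniform closeness of the kernels gives closeness of the potentials in
`C^k`: all `K_{2m} g` are `C^k` limits of potentials `K_n g'` (`rieszPotential_even_mem_ckClosure`).

The span of the `K_{2m} g` contains the constants, as `K_0 g = ∫ g`, and it is stable under
multiplication by the coordinates, because `(x_i - y_i) |x - y|^(2 m)` is an `x_i`-derivative of a
multiple of `|x - y|^(2 m + 2)` (`coord_mul_mem_evenPotentials`). Hence it contains all polynomials,
in particular the convolutions of a compactly supported function with a polynomial in `|z|²`. Taking
for the latter the Landau kernels gives the density of polynomials in `C^k`
(`exists_evenPotentials_near`), after a general `f` has been replaced by a dilation `y ↦ f (r y)`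
with `r < 1`, cut off outside the ball (`exists_contDiff_near`).

For `-d < n < 0` the kernel is locally integrable and vanishes at infinity, and both properties pass
to the convolutions of the kernel with the derivatives of `g` (`rieszPotential_decay`).
-/

open scoped Convolution
open ContinuousLinearMap (lsmul)

/-! ### Convolution with a locally integrable kernel -/

section Convolution

variable {E F : Type*} [NormedAddCommGroup E] [InnerProductSpace ℝ E] [FiniteDimensional ℝ E]
  [MeasurableSpace E] [BorelSpace E] [NormedAddCommGroup F] [NormedSpace ℝ F]

theorem integrable_convolution_integrand {φ : E → ℝ} {g : E → F} (hφ : LocallyIntegrable φ)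
    (hg : HasCompactSupport g) (hgc : Continuous g) (y : E) :
    Integrable (fun t => φ t • g (y - t)) :=
  (hg.convolutionExists_right (lsmul ℝ ℝ) hφ hgc y).integrable

theorem hasFDerivAt_convolution_lsmul {φ : E → ℝ} {g : E → F} (hφ : LocallyIntegrable φ)
    (hg : HasCompactSupport g) (hgc : ContDiff ℝ 1 g) (y : E) :
    HasFDerivAt (φ ⋆[lsmul ℝ ℝ] g) ((φ ⋆[lsmul ℝ ℝ] fderiv ℝ g) y) y := by
  have h := hg.hasFDerivAt_convolution_right (lsmul ℝ ℝ : ℝ →L[ℝ] F →L[ℝ] F) hφ hgc y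
  convert h using 1
  simp only [convolution]
  congr 1

/-- The derivatives of `φ ⋆ g` fall on `g`. -/
theorem iteratedFDeriv_convolution_lsmul [CompleteSpace F]
    {φ : E → ℝ} {g : E → F} {k : ℕ} (hφ : LocallyIntegrable φ)
    (hg : HasCompactSupport g) (hgc : ContDiff ℝ k g) {j : ℕ} (hj : j ≤ k) :
    iteratedFDeriv ℝ j (φ ⋆[lsmul ℝ ℝ] g) = φ ⋆[lsmul ℝ ℝ] iteratedFDeriv ℝ j g := by
  induction j with
  | zero =>
    ext y m
    rw [iteratedFDeriv_zero_apply, convolution_lsmul, convolution_lsmul,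
      ContinuousMultilinearMap.integral_apply]
    · simp
    · exact integrable_convolution_integrand hφ (hg.iteratedFDeriv 0)
        (hgc.continuous_iteratedFDeriv (by simp)) y
  | succ j ih =>
    have hj' : (j : WithTop ℕ∞) + 1 ≤ k := by exact_mod_cast hj
    have h1 : ContDiff ℝ 1 (iteratedFDeriv ℝ j g) :=
      hgc.iteratedFDeriv_right (by rw [add_comm]; exact hj')
    have hs := hg.iteratedFDeriv (𝕜 := ℝ) j
    ext1 y
    rw [iteratedFDeriv_succ_eq_comp_left, Function.comp_apply, ih (by omega),
      (hasFDerivAt_convolution_lsmul hφ hs h1 y).fderiv, iteratedFDeriv_succ_eq_comp_left,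
      convolution_lsmul, convolution_lsmul]
    set c := (continuousMultilinearCurryLeftEquiv ℝ (fun _ : Fin (j + 1) => E) F).symm
    refine (ContinuousLinearEquiv.integral_comp_comm (𝕜 := ℝ) (E := E →L[ℝ] E [×j]→L[ℝ] F)
      (F := E [×(j + 1)]→L[ℝ] F) (μ := volume) c.toContinuousLinearEquiv
      (fun t : E => φ t • fderiv ℝ (iteratedFDeriv ℝ j g) (y - t))).symm.trans ?_
    refine integral_congr_ae (.of_forall fun t => ?_)
    exact c.map_smul _ _

theorem contDiff_convolution_lsmul {φ : E → ℝ} {g : E → F} {k : ℕ∞} (hφ : LocallyIntegrable φ)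
    (hg : HasCompactSupport g) (hgc : ContDiff ℝ k g) : ContDiff ℝ k (φ ⋆[lsmul ℝ ℝ] g) :=
  hg.contDiff_convolution_right (lsmul ℝ ℝ) hφ hgc

theorem convolution_lsmul_sub {φ ψ : E → ℝ} {g : E → F} (hφ : LocallyIntegrable φ)
    (hψ : LocallyIntegrable ψ) (hg : HasCompactSupport g) (hgc : Continuous g) (y : E) :
    (φ ⋆[lsmul ℝ ℝ] g) y - (ψ ⋆[lsmul ℝ ℝ] g) y = ∫ x, (φ (y - x) - ψ (y - x)) • g x := by
  rw [convolution_lsmul, convolution_lsmul,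
    ← integral_sub (integrable_convolution_integrand hφ hg hgc y)
      (integrable_convolution_integrand hψ hg hgc y),
    ← integral_sub_left_eq_self (fun x => (φ (y - x) - ψ (y - x)) • g x) volume y]
  simp [sub_smul]

/-- Kernels that differ by at most `η` on `y - supp g` have convolutions with `g` that differ by at
most `η ‖g‖₁` at `y`. -/
theorem norm_convolution_lsmul_sub_le {φ ψ : E → ℝ} {g : E → F} (hφ : LocallyIntegrable φ)
    (hψ : LocallyIntegrable ψ) (hg : HasCompactSupport g) (hgc : Continuous g) {y : E} {η : ℝ}
    (h : ∀ x ∈ tsupport g, |φ (y - x) - ψ (y - x)| ≤ η) :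
    ‖(φ ⋆[lsmul ℝ ℝ] g) y - (ψ ⋆[lsmul ℝ ℝ] g) y‖ ≤ η * ∫ x, ‖g x‖ := by
  rw [convolution_lsmul_sub hφ hψ hg hgc, ← integral_const_mul]
  refine norm_integral_le_of_norm_le
    ((hgc.integrable_of_hasCompactSupport hg).norm.const_mul η) (.of_forall fun x => ?_)
  rw [norm_smul, Real.norm_eq_abs]
  by_cases hx : x ∈ tsupport g
  · exact mul_le_mul_of_nonneg_right (h x hx) (norm_nonneg _)
  · simp [image_eq_zero_of_notMem_tsupport hx]

end Convolution

section Riesz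

variable {E : Type*} [NormedAddCommGroup E] [InnerProductSpace ℝ E] [FiniteDimensional ℝ E]
  [MeasurableSpace E] [BorelSpace E]

theorem locallyIntegrable_norm_rpow [Nontrivial E] {n : ℝ}
    (hn : -(Module.finrank ℝ E : ℝ) < n) : LocallyIntegrable (fun x : E => ‖x‖ ^ n) := by
  have hball (r : ℝ) (hr : 0 < r) : IntegrableOn (fun x : E => ‖x‖ ^ n) (ball 0 r) := by
    rw [integrableOn_fun_norm_addHaar volume (f := fun t => t ^ n)]
    have hd : 1 ≤ Module.finrank ℝ E := Module.finrank_pos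
    have h := (intervalIntegral.integrableOn_Ioo_rpow_iff
      (s := n + (Module.finrank ℝ E - 1 : ℕ)) hr).2 (by push_cast [hd]; linarith)
    refine h.congr_fun (fun t ht => ?_) measurableSet_Ioo
    change t ^ (n + _) = t ^ (_ : ℕ) • t ^ n
    rw [Real.rpow_add ht.1, Real.rpow_natCast, smul_eq_mul, mul_comm]
  intro x
  exact ⟨ball 0 (‖x‖ + 1), isOpen_ball.mem_nhds (by simp), hball _ (by positivity)⟩

end Riesz

/-! ### Regularity and decay of locally integrable Riesz potentials -/

section Decay

variable {E F : Type*} [NormedAddCommGroup E] [InnerProductSpace ℝ E] [FiniteDimensional ℝ E]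
  [MeasurableSpace E] [BorelSpace E] [NormedAddCommGroup F] [NormedSpace ℝ F]

theorem tendsto_convolution_lsmul_cocompact {φ : E → ℝ} {g : E → F} (hφ : LocallyIntegrable φ)
    (hφ0 : Tendsto φ (cocompact E) (𝓝 0)) (hg : HasCompactSupport g) (hgc : Continuous g) :
    Tendsto (φ ⋆[lsmul ℝ ℝ] g) (cocompact E) (𝓝 0) := by
  have hI : 0 ≤ ∫ x, ‖g x‖ := integral_nonneg fun _ => norm_nonneg _
  rw [← cobounded_eq_cocompact] at hφ0 ⊢
  rw [Metric.tendsto_nhds]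
  intro ε hε
  set η := ε / ((∫ x, ‖g x‖) + 1) with hη
  have hη0 : 0 < η := by positivity
  have h1 := (Metric.tendsto_nhds.1 hφ0) η hη0
  obtain ⟨r, -, hr⟩ := (hasBasis_cobounded_compl_closedBall (0 : E)).eventually_iff.1 h1
  obtain ⟨R, hR⟩ := hg.isBounded.subset_closedBall (0 : E)
  refine (hasBasis_cobounded_compl_closedBall (0 : E)).eventually_iff.2 ⟨r + R, trivial, fun y hy => ?_⟩
  have hy' : r + R < ‖y‖ := by simpa using hy
  have h2 := norm_convolution_lsmul_sub_le (ψ := 0) (y := y) (η := η) hφ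
    (locallyIntegrable_zero) hg hgc (fun x hx => by
      have hx' : ‖x‖ ≤ R := by simpa using hR hx
      have h3 : r < ‖y - x‖ := by linarith [norm_sub_norm_le y x]
      simpa using (hr (by simpa using h3)).le)
  rw [zero_convolution, Pi.zero_apply, sub_zero] at h2
  rw [dist_zero_right]
  refine h2.trans_lt ?_
  rw [hη, div_mul_eq_mul_div, div_lt_iff₀ (by positivity)]
  nlinarith

theorem exists_norm_le_of_tendsto_cocompact {E F : Type*} [TopologicalSpace E]
    [NormedAddCommGroup F] {f : E → F} (hf : Continuous f)
    (h0 : Tendsto f (cocompact E) (𝓝 0)) : ∃ C : ℝ, ∀ y, ‖f y‖ ≤ C := by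
  obtain ⟨C, hC⟩ := (ZeroAtInftyContinuousMap.isBounded_range
    (⟨⟨f, hf⟩, h0⟩ : ZeroAtInftyContinuousMap E F)).exists_norm_le
  exact ⟨C, fun y => hC _ ⟨y, rfl⟩⟩

end Decay

section Riesz

variable {d : ℕ}

theorem rieszPotential_eq_convolution (n : ℝ) (g : EuclideanSpace ℝ (Fin d) → ℝ) :
    rieszPotential n g = (fun z => ‖z‖ ^ n) ⋆[lsmul ℝ ℝ] g := by
  ext y
  simp [convolution_lsmul_swap, rieszPotential, rieszKernel, norm_sub_rev]

/-- In the locally integrable range all derivatives of a Riesz potential fall on the density, so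
that they inherit the decay of the kernel. -/
theorem rieszPotential_decay (hd : 1 ≤ d) {n : ℝ} (hn : -(d : ℝ) < n) (hn0 : n < 0)
    {g : EuclideanSpace ℝ (Fin d) → ℝ} (hg : ContDiff ℝ ∞ g) (hgs : HasCompactSupport g) :
    (∀ y, Integrable (fun x => rieszKernel n x y * g x)) ∧
      ContDiff ℝ ∞ (rieszPotential n g) ∧
      ∀ j : ℕ,
        (∃ C : ℝ, ∀ y, ‖iteratedFDeriv ℝ j (rieszPotential n g) y‖ ≤ C) ∧
        Tendsto (iteratedFDeriv ℝ j (rieszPotential n g))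
          (cocompact (EuclideanSpace ℝ (Fin d))) (𝓝 0) := by
  have : Nonempty (Fin d) := ⟨⟨0, hd⟩⟩
  have hloc : LocallyIntegrable (fun x : EuclideanSpace ℝ (Fin d) => ‖x‖ ^ n) :=
    locallyIntegrable_norm_rpow (by simpa using hn)
  have hlim : Tendsto (fun x : EuclideanSpace ℝ (Fin d) => ‖x‖ ^ n)
      (cocompact (EuclideanSpace ℝ (Fin d))) (𝓝 0) := by
    have := (tendsto_rpow_neg_atTop (y := -n) (by linarith)).comp
      (tendsto_norm_cocompact_atTop (E := EuclideanSpace ℝ (Fin d)))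
    simpa [Function.comp_def] using this
  have hsmooth : ContDiff ℝ ∞ (rieszPotential n g) := by
    rw [rieszPotential_eq_convolution]
    exact contDiff_convolution_lsmul hloc hgs hg
  refine ⟨fun y => ?_, hsmooth, fun j => ?_⟩
  · have := (integrable_convolution_integrand hloc hgs hg.continuous y).comp_sub_left y
    simpa [rieszKernel, norm_sub_rev] using this
  · have h0 : Tendsto (iteratedFDeriv ℝ j (rieszPotential n g))
        (cocompact (EuclideanSpace ℝ (Fin d))) (𝓝 0) := by
      rw [rieszPotential_eq_convolution, iteratedFDeriv_convolution_lsmul (k := j) hloc hgs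
        (hg.of_le (by exact_mod_cast le_top)) le_rfl]
      exact tendsto_convolution_lsmul_cocompact hloc hlim (hgs.iteratedFDeriv j)
        (hg.continuous_iteratedFDeriv (by exact_mod_cast le_top))
    exact ⟨exists_norm_le_of_tendsto_cocompact
      (hsmooth.continuous_iteratedFDeriv (by exact_mod_cast le_top)) h0, h0⟩

end Riesz

/-! ### Test functions and integration by parts -/

namespace IsTestFunctionOn

variable {d : ℕ} {U : Set (EuclideanSpace ℝ (Fin d))} {f g : EuclideanSpace ℝ (Fin d) → ℝ}

theorem add (hf : IsTestFunctionOn U f) (hg : IsTestFunctionOn U g) :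
    IsTestFunctionOn U (fun x => f x + g x) :=
  ⟨hf.1.add hg.1, hf.2.1.add hg.2.1,
    (tsupport_add f g).trans (union_subset hf.2.2 hg.2.2)⟩

theorem mul_left (hf : ContDiff ℝ ∞ f) (hg : IsTestFunctionOn U g) :
    IsTestFunctionOn U (fun x => f x * g x) :=
  ⟨hf.mul hg.1, hg.2.1.mul_left, (tsupport_mul_subset_right).trans hg.2.2⟩

theorem zero : IsTestFunctionOn U (fun _ => 0) :=
  ⟨contDiff_const, HasCompactSupport.zero, by simp [tsupport]⟩

theorem const_mul (c : ℝ) (hg : IsTestFunctionOn U g) : IsTestFunctionOn U (fun x => c * g x) :=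
  mul_left contDiff_const hg

theorem sum {ι : Type*} (s : Finset ι) {g : ι → EuclideanSpace ℝ (Fin d) → ℝ}
    (hg : ∀ i ∈ s, IsTestFunctionOn U (g i)) : IsTestFunctionOn U (fun x => ∑ i ∈ s, g i x) := by
  classical
  induction s using Finset.induction_on with
  | empty => simpa using zero
  | insert i s hi ih =>
    simp only [Finset.sum_insert hi]
    exact (hg i (by simp)).add (ih fun j hj => hg j (by simp [hj]))

theorem fderiv_apply (hg : IsTestFunctionOn U g) (v : EuclideanSpace ℝ (Fin d)) :
    IsTestFunctionOn U (fun x => fderiv ℝ g x v) := by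
  refine ⟨(hg.1.fderiv_right (m := ∞) (by simp)).clm_apply contDiff_const,
    hg.2.1.fderiv_apply ℝ v, ?_⟩
  exact (tsupport_fderiv_apply_subset ℝ v).trans hg.2.2

/-- Kernels need only be continuous on the support of the test function. -/
theorem integrable_mul (hg : IsTestFunctionOn U g) {ψ : EuclideanSpace ℝ (Fin d) → ℝ}
    (hψ : ContinuousOn ψ U) : Integrable (fun x => ψ x * g x) := by
  refine (integrableOn_iff_integrable_of_support_subset (s := tsupport g) ?_).1
    (((hψ.mono hg.2.2).mul hg.1.continuous.continuousOn).integrableOn_compact hg.2.1)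
  exact (Function.support_mul_subset_right _ _).trans (subset_tsupport _)

theorem integral_mul_fderiv (hg : IsTestFunctionOn U g) (hU : IsOpen U)
    {ψ : EuclideanSpace ℝ (Fin d) → ℝ} (hψ : ContDiffOn ℝ 1 ψ U) (v : EuclideanSpace ℝ (Fin d)) :
    ∫ x, ψ x * fderiv ℝ g x v = -∫ x, fderiv ℝ ψ x v * g x := by
  refine integral_mul_fderiv_eq_neg_fderiv_mul_of_integrable ?_ ?_ ?_ ?_ ?_
  · exact hg.integrable_mul ((hψ.continuousOn_fderiv_of_isOpen hU le_rfl).clm_apply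
      continuousOn_const)
  · exact (hg.fderiv_apply v).integrable_mul hψ.continuousOn
  · exact hg.integrable_mul hψ.continuousOn
  · exact fun x hx => (hψ.differentiableOn one_ne_zero).differentiableAt (hU.mem_nhds (hg.2.2 hx))
  · exact fun x _ => hg.1.differentiable (by simp) x

end IsTestFunctionOn

/-! ### Potentials of shell densities and the Laplacian -/

section Shell

variable {d : ℕ}

theorem isOpen_shell : IsOpen (shell d) := isOpen_ball.sdiff isClosed_closedBall

theorem norm_sub_mem_Icc_of_mem_shell {x y : EuclideanSpace ℝ (Fin d)} (hx : x ∈ shell d)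
    (hy : y ∈ closedBall 0 1) : ‖x - y‖ ∈ Icc 2 5 := by
  have h1 : ‖x‖ < 4 := by simpa using hx.1
  have h2 : 3 < ‖x‖ := by simpa using hx.2
  have h3 : ‖y‖ ≤ 1 := by simpa using hy
  exact ⟨by linarith [norm_sub_norm_le x y], by linarith [norm_sub_le x y]⟩

theorem norm_sub_ne_zero_of_mem_shell {x y : EuclideanSpace ℝ (Fin d)} (hx : x ∈ shell d)
    (hy : y ∈ closedBall 0 1) : ‖x - y‖ ≠ 0 := by
  have := (norm_sub_mem_Icc_of_mem_shell hx hy).1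
  linarith

theorem contDiffOn_rieszKernel (n : ℝ) {y : EuclideanSpace ℝ (Fin d)} (hy : y ∈ closedBall 0 1) :
    ContDiffOn ℝ ∞ (fun x => rieszKernel n x y) (shell d) := by
  intro x hx
  have h0 := norm_sub_ne_zero_of_mem_shell hx hy
  have h1 : ContDiffAt ℝ ∞ (fun x => ‖x - y‖) x :=
    (contDiffAt_id.sub contDiffAt_const).norm ℝ (norm_ne_zero_iff.1 h0)
  exact (h1.rpow_const_of_ne h0).contDiffWithinAt

theorem fderiv_rieszKernel (n : ℝ) {x y : EuclideanSpace ℝ (Fin d)} (h0 : ‖x - y‖ ≠ 0)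
    (v : EuclideanSpace ℝ (Fin d)) :
    fderiv ℝ (fun x => rieszKernel n x y) x v =
      n * rieszKernel (n - 2) x y * inner ℝ (x - y) v := by
  have hpos : 0 < ‖x - y‖ := by positivity
  have h1 : HasFDerivAt (fun x : EuclideanSpace ℝ (Fin d) => ‖x - y‖ ^ 2)
      (2 • innerSL ℝ (x - y)) x := by
    simpa using ((hasFDerivAt_id x).sub_const y).norm_sq
  have h2 := h1.rpow_const (p := n / 2) (Or.inl (by positivity))
  have h3 : (fun x => rieszKernel n x y) = fun x => (‖x - y‖ ^ 2) ^ (n / 2) := by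
    ext z
    rw [rieszKernel, ← Real.rpow_natCast, ← Real.rpow_mul (norm_nonneg _)]
    congr 1; push_cast; ring
  have h4 : (‖x - y‖ ^ 2) ^ (n / 2 - 1) = rieszKernel (n - 2) x y := by
    rw [rieszKernel, ← Real.rpow_natCast, ← Real.rpow_mul (norm_nonneg _)]
    congr 1; push_cast; ring
  rw [h3, h2.fderiv, h4]
  simp only [smul_apply, innerSL_apply_apply, smul_eq_mul, nsmul_eq_mul]
  push_cast
  ring

theorem rieszKernel_mul_sq (n : ℝ) {x y : EuclideanSpace ℝ (Fin d)} (h0 : ‖x - y‖ ≠ 0) :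
    rieszKernel (n - 2) x y * ‖x - y‖ ^ 2 = rieszKernel n x y := by
  have hpos : 0 < ‖x - y‖ := by positivity
  rw [rieszKernel, rieszKernel, ← Real.rpow_natCast, ← Real.rpow_add hpos]
  congr 1; push_cast; ring

/-- One integration by parts against a coordinate direction. -/
theorem rieszPotential_fderiv_single (n : ℝ) {g : EuclideanSpace ℝ (Fin d) → ℝ}
    (hg : IsTestFunctionOn (shell d) g) {y : EuclideanSpace ℝ (Fin d)} (hy : y ∈ closedBall 0 1)
    (i : Fin d) :
    rieszPotential n (fun x => fderiv ℝ g x (EuclideanSpace.single i 1)) y =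
      -(n * ∫ x, rieszKernel (n - 2) x y * ((x i - y i) * g x)) := by
  rw [rieszPotential, hg.integral_mul_fderiv isOpen_shell
    ((contDiffOn_rieszKernel n hy).of_le (by simp)), ← integral_const_mul]
  congr 1
  refine integral_congr_ae (.of_forall fun x => ?_)
  by_cases hx : x ∈ tsupport g
  · dsimp only
    rw [fderiv_rieszKernel n (norm_sub_ne_zero_of_mem_shell (hg.2.2 hx) hy),
      EuclideanSpace.inner_single_right]
    simp
    ring
  · simp [image_eq_zero_of_notMem_tsupport hx]

/-- Green's identity with the kernel identity `Δ|x - y|^n = n (n + d - 2) |x - y|^(n - 2)`. -/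
theorem rieszPotential_laplacian (n : ℝ) {g : EuclideanSpace ℝ (Fin d) → ℝ}
    (hg : IsTestFunctionOn (shell d) g) {y : EuclideanSpace ℝ (Fin d)} (hy : y ∈ closedBall 0 1) :
    rieszPotential n (fun x => ∑ i, fderiv ℝ (fun z => fderiv ℝ g z (EuclideanSpace.single i 1)) x
      (EuclideanSpace.single i 1)) y = n * (n + d - 2) * rieszPotential (n - 2) g y := by
  have hk (s : ℝ) := (contDiffOn_rieszKernel (d := d) s hy).continuousOn
  have hcoord (i : Fin d) :
      ContDiff ℝ ∞ (fun x : EuclideanSpace ℝ (Fin d) => x i - y i) := by fun_prop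
  have hi (i : Fin d) : rieszPotential n (fun x => fderiv ℝ (fun z => fderiv ℝ g z
      (EuclideanSpace.single i 1)) x (EuclideanSpace.single i 1)) y =
      n * ((n - 2) * (∫ x, rieszKernel (n - 2 - 2) x y * ((x i - y i) * ((x i - y i) * g x)))
        + rieszPotential (n - 2) g y) := by
    have hw := hg.mul_left (hcoord i)
    rw [rieszPotential_fderiv_single n (hg.fderiv_apply _) hy i, ← mul_neg]
    congr 1
    have h1 := rieszPotential_fderiv_single (n - 2) hw hy i
    -- The product rule `∂ᵢ((xᵢ - yᵢ) g) = (xᵢ - yᵢ) ∂ᵢg + g`.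
    have h2 (x : EuclideanSpace ℝ (Fin d)) :
        fderiv ℝ (fun x => (x i - y i) * g x) x (EuclideanSpace.single i 1) =
          (x i - y i) * fderiv ℝ g x (EuclideanSpace.single i 1) + g x := by
      have hc : HasFDerivAt (fun x : EuclideanSpace ℝ (Fin d) => x i - y i)
          (EuclideanSpace.proj i : EuclideanSpace ℝ (Fin d) →L[ℝ] ℝ) x :=
        (EuclideanSpace.proj i : EuclideanSpace ℝ (Fin d) →L[ℝ] ℝ).hasFDerivAt.sub_const (y i)
      rw [(hc.fun_mul (hg.1.differentiable (by simp) x).hasFDerivAt).fderiv]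
      simp
    have h3 : rieszPotential (n - 2) (fun x => fderiv ℝ (fun x => (x i - y i) * g x) x
        (EuclideanSpace.single i 1)) y = (∫ x, rieszKernel (n - 2) x y *
          ((x i - y i) * fderiv ℝ g x (EuclideanSpace.single i 1))) +
            rieszPotential (n - 2) g y := by
      rw [rieszPotential, rieszPotential, ← integral_add
        (((hg.fderiv_apply _).mul_left (hcoord i)).integrable_mul (hk _))
        (hg.integrable_mul (hk _))]
      simp only [h2, mul_add]
    linarith
  have hsum : ∑ i : Fin d, (∫ x, rieszKernel (n - 2 - 2) x y *
      ((x i - y i) * ((x i - y i) * g x))) = rieszPotential (n - 2) g y := by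
    rw [rieszPotential, ← integral_finsetSum _ fun i _ =>
      ((hg.mul_left (hcoord i)).mul_left (hcoord i)).integrable_mul (hk _)]
    refine integral_congr_ae (.of_forall fun x => ?_)
    by_cases hx : x ∈ tsupport g
    · dsimp only
      rw [← rieszKernel_mul_sq (n - 2) (norm_sub_ne_zero_of_mem_shell (hg.2.2 hx) hy),
        EuclideanSpace.real_norm_sq_eq, Finset.mul_sum, Finset.sum_mul]
      refine Finset.sum_congr rfl fun i _ => ?_
      simp only [PiLp.sub_apply]
      ring
    · simp [image_eq_zero_of_notMem_tsupport hx]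
  have hsum' : rieszPotential n (fun x => ∑ i, fderiv ℝ (fun z => fderiv ℝ g z
      (EuclideanSpace.single i 1)) x (EuclideanSpace.single i 1)) y =
      ∑ i, rieszPotential n (fun x => fderiv ℝ (fun z => fderiv ℝ g z
        (EuclideanSpace.single i 1)) x (EuclideanSpace.single i 1)) y := by
    simp only [rieszPotential, Finset.mul_sum]
    exact integral_finsetSum _ fun i _ =>
      ((hg.fderiv_apply _).fderiv_apply _).integrable_mul (hk _)
  rw [hsum', Finset.sum_congr rfl fun i _ => hi i, ← Finset.mul_sum, Finset.sum_add_distrib,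
    ← Finset.mul_sum, hsum]
  simp
  ring

/-- Since `Δ` lowers the exponent by two with a factor that the hypotheses keep away from zero, the
potentials of exponent `n - 2 j` are also potentials of exponent `n`. -/
theorem exists_rieszPotential_eq_rieszPotential_sub {n : ℝ}
    (hn : ∀ m : ℕ, n + (d : ℝ) ≠ 2 * ((m : ℝ) + 1)) (hn_even : ∀ m : ℕ, n ≠ 2 * (m : ℝ)) (j : ℕ) :
    ∀ g : EuclideanSpace ℝ (Fin d) → ℝ, IsTestFunctionOn (shell d) g →
      ∃ g', IsTestFunctionOn (shell d) g' ∧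
        EqOn (rieszPotential (n - 2 * j) g) (rieszPotential n g') (closedBall 0 1) := by
  induction j with
  | zero => exact fun g hg => ⟨g, hg, fun y _ => by simp⟩
  | succ j ih =>
    intro g hg
    set s : ℝ := n - 2 * j with hs
    have hc : s * (s + d - 2) ≠ 0 :=
      mul_ne_zero (fun h => hn_even j (by linarith)) (fun h => hn j (by linarith))
    obtain ⟨g', hg', h⟩ := ih _ ((IsTestFunctionOn.sum Finset.univ fun i _ =>
      (hg.fderiv_apply (EuclideanSpace.single i 1)).fderiv_apply
        (EuclideanSpace.single i 1)).const_mul (s * (s + d - 2))⁻¹)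
    refine ⟨g', hg', fun y hy => ?_⟩
    rw [← h hy, show n - 2 * ((j + 1 : ℕ) : ℝ) = s - 2 by push_cast [hs]; ring]
    have h1 := rieszPotential_laplacian s hg hy
    have h2 : rieszPotential s (fun x => (s * (s + d - 2))⁻¹ * ∑ i, fderiv ℝ (fun z => fderiv ℝ g z
        (EuclideanSpace.single i 1)) x (EuclideanSpace.single i 1)) y =
        (s * (s + d - 2))⁻¹ * rieszPotential s (fun x => ∑ i, fderiv ℝ (fun z => fderiv ℝ g z
        (EuclideanSpace.single i 1)) x (EuclideanSpace.single i 1)) y := by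
      simp only [rieszPotential]
      rw [← integral_const_mul]
      congr 1; ext x; ring
    rw [h2, h1, inv_mul_cancel_left₀ hc]

end Shell

/-! ### The closure of the potentials in `C^k` of the ball -/

section Closure

variable {d : ℕ}

theorem uniqueDiffOn_closedBall_one :
    UniqueDiffOn ℝ (closedBall (0 : EuclideanSpace ℝ (Fin d)) 1) :=
  uniqueDiffOn_convex (convex_closedBall 0 1)
    ((nonempty_ball.2 one_pos).mono ball_subset_interior_closedBall)

theorem iteratedFDerivWithin_closedBall_eq {h : EuclideanSpace ℝ (Fin d) → ℝ} {k j : ℕ}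
    (hh : ContDiff ℝ k h) (hj : j ≤ k) {y : EuclideanSpace ℝ (Fin d)} (hy : y ∈ closedBall 0 1) :
    iteratedFDerivWithin ℝ j h (closedBall 0 1) y = iteratedFDeriv ℝ j h y :=
  iteratedFDerivWithin_eq_iteratedFDeriv uniqueDiffOn_closedBall_one
    (hh.of_le (by exact_mod_cast hj)).contDiffAt hy

/-- Between the shell and the unit ball only the values of the kernel at distances `≥ 2` matter. -/
theorem convolution_eq_integral_of_eqOn {φ ψ g : EuclideanSpace ℝ (Fin d) → ℝ}
    (hφψ : ∀ z, 2 ≤ ‖z‖ → φ z = ψ z) (hg : IsTestFunctionOn (shell d) g)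
    {y : EuclideanSpace ℝ (Fin d)} (hy : y ∈ closedBall 0 1) :
    (φ ⋆[lsmul ℝ ℝ] g) y = ∫ x, ψ (y - x) * g x := by
  rw [convolution_lsmul_swap]
  refine integral_congr_ae (.of_forall fun x => ?_)
  by_cases hx : x ∈ tsupport g
  · have := (norm_sub_mem_Icc_of_mem_shell (hg.2.2 hx) hy).1
    simp [hφψ (y - x) (by rwa [norm_sub_rev])]
  · simp [image_eq_zero_of_notMem_tsupport hx]

/-- The kernel `|z|^n` with its singularity at the origin removed. On the unit ball it has the same
potentials of shell densities. -/
noncomputable def truncatedKernel (n : ℝ) (z : EuclideanSpace ℝ (Fin d)) : ℝ := max 1 ‖z‖ ^ n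

theorem continuous_truncatedKernel (n : ℝ) :
    Continuous (truncatedKernel (d := d) n) :=
  (continuous_const.max continuous_norm).rpow_const
    fun z => Or.inl (lt_of_lt_of_le one_pos (le_max_left 1 ‖z‖)).ne'

theorem truncatedKernel_eq (n : ℝ) {z : EuclideanSpace ℝ (Fin d)} (hz : 2 ≤ ‖z‖) :
    truncatedKernel n z = ‖z‖ ^ n := by
  rw [truncatedKernel, max_eq_right (by linarith)]

theorem eqOn_rieszPotential_convolution (n : ℝ) {g : EuclideanSpace ℝ (Fin d) → ℝ}
    (hg : IsTestFunctionOn (shell d) g) :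
    EqOn (rieszPotential n g) (truncatedKernel n ⋆[lsmul ℝ ℝ] g) (closedBall 0 1) := by
  intro y hy
  rw [convolution_eq_integral_of_eqOn (ψ := fun z => ‖z‖ ^ n)
    (fun z hz => truncatedKernel_eq n hz) hg hy]
  simp [rieszPotential, rieszKernel, norm_sub_rev]

theorem contDiffOn_rieszPotential (n : ℝ) {g : EuclideanSpace ℝ (Fin d) → ℝ}
    (hg : IsTestFunctionOn (shell d) g) :
    ContDiffOn ℝ ∞ (rieszPotential n g) (closedBall 0 1) :=
  (contDiff_convolution_lsmul (continuous_truncatedKernel n).locallyIntegrable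
    hg.2.1 hg.1).contDiffOn.congr (eqOn_rieszPotential_convolution n hg)

/-- The functions on the closed unit ball that are limits, in the topology of `C^k`, of potentials
of exponent `n` of shell densities. The topology is expressed with the operator norms of the full
iterated derivatives relative to the ball. -/
def ckClosure (d : ℕ) (n : ℝ) (k : ℕ) : Set (EuclideanSpace ℝ (Fin d) → ℝ) :=
  {h | ContDiffOn ℝ k h (closedBall 0 1) ∧ ∀ δ : ℝ, 0 < δ → ∃ g, IsTestFunctionOn (shell d) g ∧
    ∀ j ≤ k, ∀ y ∈ closedBall (0 : EuclideanSpace ℝ (Fin d)) 1,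
      ‖iteratedFDerivWithin ℝ j h (closedBall 0 1) y -
        iteratedFDerivWithin ℝ j (rieszPotential n g) (closedBall 0 1) y‖ ≤ δ}

variable {n : ℝ} {k : ℕ} {f h : EuclideanSpace ℝ (Fin d) → ℝ}

theorem contDiffOn_rieszPotential_nat (n : ℝ) (k : ℕ) {g : EuclideanSpace ℝ (Fin d) → ℝ}
    (hg : IsTestFunctionOn (shell d) g) :
    ContDiffOn ℝ k (rieszPotential n g) (closedBall 0 1) :=
  (contDiffOn_rieszPotential n hg).of_le (by exact_mod_cast le_top)

theorem integrable_rieszKernel_mul (n : ℝ) {g : EuclideanSpace ℝ (Fin d) → ℝ}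
    (hg : IsTestFunctionOn (shell d) g) {y : EuclideanSpace ℝ (Fin d)} (hy : y ∈ closedBall 0 1) :
    Integrable (fun x => rieszKernel n x y * g x) :=
  hg.integrable_mul (contDiffOn_rieszKernel n hy).continuousOn

theorem rieszPotential_add (n : ℝ) {f g : EuclideanSpace ℝ (Fin d) → ℝ}
    (hf : IsTestFunctionOn (shell d) f) (hg : IsTestFunctionOn (shell d) g)
    {y : EuclideanSpace ℝ (Fin d)} (hy : y ∈ closedBall 0 1) :
    rieszPotential n (fun x => f x + g x) y = rieszPotential n f y + rieszPotential n g y := by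
  simp only [rieszPotential, mul_add]
  exact integral_add (integrable_rieszKernel_mul n hf hy) (integrable_rieszKernel_mul n hg hy)

theorem rieszPotential_const_mul (n c : ℝ) (g : EuclideanSpace ℝ (Fin d) → ℝ)
    (y : EuclideanSpace ℝ (Fin d)) :
    rieszPotential n (fun x => c * g x) y = c * rieszPotential n g y := by
  simp only [rieszPotential, mul_left_comm _ c, integral_const_mul]

theorem ckClosure_congr (hh : h ∈ ckClosure d n k) (hfh : EqOn f h (closedBall 0 1)) :
    f ∈ ckClosure d n k := by
  refine ⟨hh.1.congr hfh, fun δ hδ => ?_⟩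
  obtain ⟨g, hg, hgh⟩ := hh.2 δ hδ
  refine ⟨g, hg, fun j hj y hy => ?_⟩
  rw [iteratedFDerivWithin_congr hfh hy]
  exact hgh j hj y hy

theorem add_mem_ckClosure (hf : f ∈ ckClosure d n k) (hh : h ∈ ckClosure d n k) :
    f + h ∈ ckClosure d n k := by
  refine ⟨hf.1.add hh.1, fun δ hδ => ?_⟩
  obtain ⟨g₁, hg₁, h₁⟩ := hf.2 (δ / 2) (by positivity)
  obtain ⟨g₂, hg₂, h₂⟩ := hh.2 (δ / 2) (by positivity)
  refine ⟨_, hg₁.add hg₂, fun j hj y hy => ?_⟩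
  have hjk : (j : WithTop ℕ∞) ≤ k := by exact_mod_cast hj
  have e : EqOn (rieszPotential n fun x => g₁ x + g₂ x) (rieszPotential n g₁ + rieszPotential n g₂)
      (closedBall 0 1) := fun y hy => rieszPotential_add n hg₁ hg₂ hy
  rw [iteratedFDerivWithin_congr e hy,
    iteratedFDerivWithin_add_apply ((hf.1.of_le hjk) y hy) ((hh.1.of_le hjk) y hy)
      uniqueDiffOn_closedBall_one hy,
    iteratedFDerivWithin_add_apply ((contDiffOn_rieszPotential_nat n j hg₁) y hy)
      ((contDiffOn_rieszPotential_nat n j hg₂) y hy) uniqueDiffOn_closedBall_one hy,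
    add_sub_add_comm]
  exact (norm_add_le _ _).trans (by linarith [h₁ j hj y hy, h₂ j hj y hy])

theorem smul_mem_ckClosure (c : ℝ) (hh : h ∈ ckClosure d n k) : c • h ∈ ckClosure d n k := by
  refine ⟨hh.1.const_smul c, fun δ hδ => ?_⟩
  obtain ⟨g, hg, hgh⟩ := hh.2 (δ / (|c| + 1)) (by positivity)
  refine ⟨_, hg.const_mul c, fun j hj y hy => ?_⟩
  have hjk : (j : WithTop ℕ∞) ≤ k := by exact_mod_cast hj
  have e : EqOn (rieszPotential n fun x => c * g x) (c • rieszPotential n g)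
      (closedBall 0 1) := fun y _ => rieszPotential_const_mul n c g y
  rw [iteratedFDerivWithin_congr e hy,
    iteratedFDerivWithin_const_smul_apply ((hh.1.of_le hjk) y hy) uniqueDiffOn_closedBall_one hy,
    iteratedFDerivWithin_const_smul_apply ((contDiffOn_rieszPotential_nat n j hg) y hy)
      uniqueDiffOn_closedBall_one hy, ← smul_sub, norm_smul, Real.norm_eq_abs]
  have := hgh j hj y hy
  rw [le_div_iff₀ (by positivity)] at this
  nlinarith [norm_nonneg (iteratedFDerivWithin ℝ j h (closedBall 0 1) y -
        iteratedFDerivWithin ℝ j (rieszPotential n g) (closedBall 0 1) y)]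

theorem zero_mem_ckClosure : (0 : EuclideanSpace ℝ (Fin d) → ℝ) ∈ ckClosure d n k := by
  refine ⟨contDiffOn_const, fun δ hδ => ⟨_, IsTestFunctionOn.zero, fun j hj y hy => ?_⟩⟩
  have e : rieszPotential n (fun _ : EuclideanSpace ℝ (Fin d) => (0 : ℝ)) = 0 := by
    ext y; simp [rieszPotential]
  rw [e, sub_self, norm_zero]
  exact hδ.le

/-- `ckClosure` as a vector space of functions. -/
def ckClosureSubmodule (d : ℕ) (n : ℝ) (k : ℕ) :
    Submodule ℝ (EuclideanSpace ℝ (Fin d) → ℝ) where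
  carrier := ckClosure d n k
  add_mem' := add_mem_ckClosure
  zero_mem' := zero_mem_ckClosure
  smul_mem' c _ := smul_mem_ckClosure c

/-- `ckClosure` is closed in the topology of `C^k`. -/
theorem mem_ckClosure_of_forall_exists (hf : ContDiffOn ℝ k f (closedBall 0 1))
    (H : ∀ δ : ℝ, 0 < δ → ∃ h ∈ ckClosure d n k, ∀ j ≤ k,
      ∀ y ∈ closedBall (0 : EuclideanSpace ℝ (Fin d)) 1,
      ‖iteratedFDerivWithin ℝ j f (closedBall 0 1) y -
        iteratedFDerivWithin ℝ j h (closedBall 0 1) y‖ ≤ δ) : f ∈ ckClosure d n k := by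
  refine ⟨hf, fun δ hδ => ?_⟩
  obtain ⟨h, hh, h₁⟩ := H (δ / 2) (by positivity)
  obtain ⟨g, hg, h₂⟩ := hh.2 (δ / 2) (by positivity)
  refine ⟨g, hg, fun j hj y hy => ?_⟩
  rw [← sub_add_sub_cancel]
  exact (norm_add_le _ _).trans (by linarith [h₁ j hj y hy, h₂ j hj y hy])

/-- A polynomial in `|x - y|⁻²` times `|x - y|^n` yields no new potentials. -/
theorem exists_rieszPotential_eq_integral_polynomial
    (hn : ∀ m : ℕ, n + (d : ℝ) ≠ 2 * ((m : ℝ) + 1)) (hn_even : ∀ m : ℕ, n ≠ 2 * (m : ℝ))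
    {g : EuclideanSpace ℝ (Fin d) → ℝ} (hg : IsTestFunctionOn (shell d) g) (q : Polynomial ℝ) :
    ∃ g', IsTestFunctionOn (shell d) g' ∧ ∀ y ∈ closedBall (0 : EuclideanSpace ℝ (Fin d)) 1,
      ∫ x, rieszKernel n x y * q.eval (rieszKernel (-2) x y) * g x = rieszPotential n g' y := by
  have hcont (q : Polynomial ℝ) {y : EuclideanSpace ℝ (Fin d)} (hy : y ∈ closedBall 0 1) :
      Integrable fun x => rieszKernel n x y * q.eval (rieszKernel (-2) x y) * g x :=
    hg.integrable_mul ((contDiffOn_rieszKernel n hy).continuousOn.mul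
      (q.continuous.comp_continuousOn (contDiffOn_rieszKernel (-2) hy).continuousOn))
  induction q using Polynomial.induction_on' with
  | add p q hp hq =>
    obtain ⟨g₁, hg₁, h₁⟩ := hp
    obtain ⟨g₂, hg₂, h₂⟩ := hq
    refine ⟨_, hg₁.add hg₂, fun y hy => ?_⟩
    rw [rieszPotential_add n hg₁ hg₂ hy, ← h₁ y hy, ← h₂ y hy,
      ← integral_add (hcont p hy) (hcont q hy)]
    simp only [Polynomial.eval_add, mul_add, add_mul]
  | monomial j a =>
    obtain ⟨g', hg', h'⟩ := exists_rieszPotential_eq_rieszPotential_sub hn hn_even j _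
      (hg.const_mul a)
    refine ⟨g', hg', fun y hy => ?_⟩
    rw [← h' hy, rieszPotential]
    refine integral_congr_ae (.of_forall fun x => ?_)
    by_cases hx : x ∈ tsupport g
    · have h0 := norm_sub_ne_zero_of_mem_shell (hg.2.2 hx) hy
      have hpos : 0 < ‖x - y‖ := by positivity
      have : rieszKernel (n - 2 * j) x y = rieszKernel n x y * rieszKernel (-2) x y ^ j := by
        rw [rieszKernel, rieszKernel, rieszKernel, ← Real.rpow_natCast,
          ← Real.rpow_mul hpos.le, ← Real.rpow_add hpos]
        congr 1; ring
      simp only [Polynomial.eval_monomial, this]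
      ring
    · simp [image_eq_zero_of_notMem_tsupport hx]

end Closure

/-! ### Even exponents and polynomials -/

section Polynomials

variable {d : ℕ} {n : ℝ}

/-- Weierstrass approximation in the variable `s = t⁻²`, for `t = |x - y|` in the range of distances
between the shell and the unit ball. -/
theorem exists_polynomial_rpow_near (n : ℝ) (m : ℕ) {η : ℝ} (hη : 0 < η) :
    ∃ q : Polynomial ℝ, ∀ t ∈ Icc (2 : ℝ) 5,
      |t ^ (2 * m : ℝ) - t ^ n * q.eval (t ^ (-2 : ℝ))| ≤ η := by
  have hcont : ContinuousOn (fun t : ℝ => t ^ n) (Icc 2 5) := fun t ht =>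
    (Real.continuousAt_rpow_const t n
      (Or.inl (by linarith [ht.1]))).continuousWithinAt
  obtain ⟨C, hC⟩ := isCompact_Icc.exists_bound_of_continuousOn hcont
  have hC0 : 0 ≤ C := (norm_nonneg _).trans (hC 2 (by norm_num))
  have hF : ContinuousOn (fun s : ℝ => s ^ (n / 2 - m)) (Icc (1 / 25) (1 / 4)) := fun s hs =>
    (Real.continuousAt_rpow_const s _
      (Or.inl (by linarith [hs.1]))).continuousWithinAt
  obtain ⟨q, hq⟩ := exists_polynomial_near_of_continuousOn _ _ _ hF (η / (C + 1)) (by positivity)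
  refine ⟨q, fun t ht => ?_⟩
  have ht0 : 0 < t := by linarith [ht.1]
  have hs : t ^ (-2 : ℝ) ∈ Icc (1 / 25 : ℝ) (1 / 4) := by
    rw [Real.rpow_neg ht0.le, show (2 : ℝ) = ((2 : ℕ) : ℝ) by norm_num, Real.rpow_natCast,
      ← one_div]
    constructor
    · exact one_div_le_one_div_of_le (by positivity) (by nlinarith [ht.2])
    · exact one_div_le_one_div_of_le (by norm_num) (by nlinarith [ht.1])
  have h1 := (hq _ hs).le
  rw [← Real.rpow_mul ht0.le, abs_sub_comm] at h1
  have h2 : t ^ (2 * m : ℝ) = t ^ n * t ^ (-2 * (n / 2 - m)) := by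
    rw [← Real.rpow_add ht0]; congr 1; ring
  have h3 : |t ^ n| ≤ C := hC t ht
  rw [h2, ← mul_sub, abs_mul]
  calc |t ^ n| * |t ^ (-2 * (n / 2 - m)) - q.eval (t ^ (-2 : ℝ))|
      ≤ C * (η / (C + 1)) := mul_le_mul h3 h1 (abs_nonneg _) hC0
    _ ≤ η := by
      rw [mul_div_assoc', div_le_iff₀ (by positivity)]
      nlinarith

/-- The potentials with even exponents are limits of potentials of exponent `n`: the kernels are
uniformly close at the relevant distances, and the derivatives of both potentials fall on the
density. -/
theorem rieszPotential_even_mem_ckClosure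
    (hn : ∀ m : ℕ, n + (d : ℝ) ≠ 2 * ((m : ℝ) + 1)) (hn_even : ∀ m : ℕ, n ≠ 2 * (m : ℝ)) (k m : ℕ)
    {g : EuclideanSpace ℝ (Fin d) → ℝ} (hg : IsTestFunctionOn (shell d) g) :
    rieszPotential (2 * m) g ∈ ckClosure d n k := by
  refine ⟨contDiffOn_rieszPotential_nat _ _ hg, fun δ hδ => ?_⟩
  have hI (j : ℕ) : 0 ≤ ∫ x, ‖iteratedFDeriv ℝ j g x‖ := integral_nonneg fun _ => norm_nonneg _
  set M := ∑ j ∈ Finset.range (k + 1), ∫ x, ‖iteratedFDeriv ℝ j g x‖ with hM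
  have hM0 : 0 ≤ M := Finset.sum_nonneg fun j _ => hI j
  set η := δ / (M + 1) with hη
  have hη0 : 0 < η := by positivity
  obtain ⟨q, hq⟩ := exists_polynomial_rpow_near n m hη0
  obtain ⟨g', hg', h'⟩ := exists_rieszPotential_eq_integral_polynomial hn hn_even hg q
  refine ⟨g', hg', fun j hj y hy => ?_⟩
  set ψ : EuclideanSpace ℝ (Fin d) → ℝ :=
    fun z => truncatedKernel n z * q.eval (truncatedKernel (-2) z) with hψ
  have hψc : Continuous ψ := (continuous_truncatedKernel n).mul
    (q.continuous.comp (continuous_truncatedKernel (-2)))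
  have hψg : EqOn (rieszPotential n g') (ψ ⋆[lsmul ℝ ℝ] g) (closedBall 0 1) := by
    intro y hy
    rw [convolution_eq_integral_of_eqOn (ψ := fun z => ‖z‖ ^ n * q.eval (‖z‖ ^ (-2 : ℝ))) _ hg hy,
      ← h' y hy]
    · simp only [rieszKernel, norm_sub_rev]
    · intro z hz
      simp only [hψ, truncatedKernel_eq _ hz]
  have hgk : ContDiff ℝ k g := hg.1.of_le (by exact_mod_cast le_top)
  have hgj : Continuous (iteratedFDeriv ℝ j g) :=
    hg.1.continuous_iteratedFDeriv (by exact_mod_cast le_top)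
  have hloc := (continuous_truncatedKernel (d := d) (2 * m)).locallyIntegrable
    (μ := volume)
  have hloc' := hψc.locallyIntegrable (μ := volume)
  rw [iteratedFDerivWithin_congr (eqOn_rieszPotential_convolution _ hg) hy,
    iteratedFDerivWithin_congr hψg hy,
    iteratedFDerivWithin_closedBall_eq (contDiff_convolution_lsmul hloc hg.2.1 hgk) hj hy,
    iteratedFDerivWithin_closedBall_eq (contDiff_convolution_lsmul hloc' hg.2.1 hgk) hj hy,
    iteratedFDeriv_convolution_lsmul hloc hg.2.1 hgk hj,
    iteratedFDeriv_convolution_lsmul hloc' hg.2.1 hgk hj]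
  refine (norm_convolution_lsmul_sub_le (η := η) hloc hloc' (hg.2.1.iteratedFDeriv j) hgj
    fun x hx => ?_).trans ?_
  · have hxy := norm_sub_mem_Icc_of_mem_shell (hg.2.2 (tsupport_iteratedFDeriv_subset j hx)) hy
    rw [norm_sub_rev] at hxy
    simp only [hψ, truncatedKernel_eq _ hxy.1]
    exact hq _ hxy
  · have : ∫ x, ‖iteratedFDeriv ℝ j g x‖ ≤ M :=
      Finset.single_le_sum (f := fun j => ∫ x, ‖iteratedFDeriv ℝ j g x‖) (fun i _ => hI i)
        (Finset.mem_range.2 (by omega))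
    calc η * ∫ x, ‖iteratedFDeriv ℝ j g x‖ ≤ η * M := by gcongr
      _ ≤ δ := by
        rw [hη, div_mul_eq_mul_div, div_le_iff₀ (by positivity)]
        nlinarith

/-- The span of the functions that on the closed unit ball are potentials with a nonnegative even
exponent. These functions are polynomials there, and for `d ≥ 1` every polynomial arises. -/
def evenPotentials (d : ℕ) : Submodule ℝ (EuclideanSpace ℝ (Fin d) → ℝ) :=
  Submodule.span ℝ {h | ∃ (m : ℕ) (g : EuclideanSpace ℝ (Fin d) → ℝ),
    IsTestFunctionOn (shell d) g ∧ EqOn h (rieszPotential (2 * m) g) (closedBall 0 1)}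

theorem evenPotentials_subset_ckClosure
    (hn : ∀ m : ℕ, n + (d : ℝ) ≠ 2 * ((m : ℝ) + 1)) (hn_even : ∀ m : ℕ, n ≠ 2 * (m : ℝ)) (k : ℕ)
    {h : EuclideanSpace ℝ (Fin d) → ℝ} (hh : h ∈ evenPotentials d) : h ∈ ckClosure d n k := by
  have : evenPotentials d ≤ ckClosureSubmodule d n k := by
    refine Submodule.span_le.2 ?_
    rintro h ⟨m, g, hg, hgh⟩
    exact ckClosure_congr (rieszPotential_even_mem_ckClosure hn hn_even k m hg) hgh
  exact this hh

/-- The multiplication by `yᵢ = xᵢ - (xᵢ - yᵢ)` stays in the span, because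
`(xᵢ - yᵢ) |x - y|^(2 m)` is a multiple of the `xᵢ`-derivative of `|x - y|^(2 m + 2)`. -/
theorem coord_mul_mem_evenPotentials (i : Fin d) {h : EuclideanSpace ℝ (Fin d) → ℝ}
    (hh : h ∈ evenPotentials d) : (fun y => y i * h y) ∈ evenPotentials d := by
  induction hh using Submodule.span_induction with
  | zero =>
    convert (evenPotentials d).zero_mem using 1
    ext y; simp
  | add f g _ _ hf hg =>
    have := (evenPotentials d).add_mem hf hg
    convert this using 1
    ext y; simp [mul_add]
  | smul c f _ hf =>
    have := (evenPotentials d).smul_mem c hf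
    convert this using 1
    ext y; simp; ring
  | mem h hh =>
    obtain ⟨m, g, hg, hgh⟩ := hh
    have hcoord : ContDiff ℝ ∞ (fun x : EuclideanSpace ℝ (Fin d) => x i) := by fun_prop
    set g' : EuclideanSpace ℝ (Fin d) → ℝ :=
      fun x => (2 * (m + 1 : ℝ))⁻¹ * fderiv ℝ g x (EuclideanSpace.single i 1) with hg'
    have hg't : IsTestFunctionOn (shell d) g' := (hg.fderiv_apply _).const_mul _
    have h2 : rieszPotential (2 * (m + 1 : ℕ)) g' ∈ evenPotentials d :=
      Submodule.subset_span ⟨m + 1, g', hg't, fun _ _ => rfl⟩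
    have h1 : (fun y => y i * h y - rieszPotential (2 * (m + 1 : ℕ)) g' y) ∈ evenPotentials d := by
      refine Submodule.subset_span ⟨m, _, hg.mul_left hcoord, fun y hy => ?_⟩
      have e := rieszPotential_fderiv_single (2 * (m + 1 : ℕ)) hg hy i
      have h3 : (2 * ((m + 1 : ℕ) : ℝ)) - 2 = 2 * m := by push_cast; ring
      have h4 : ∫ x, rieszKernel (2 * m) x y * ((x i - y i) * g x) =
          rieszPotential (2 * m) (fun x => x i * g x) y - y i * rieszPotential (2 * m) g y := by
        simp only [rieszPotential]
        rw [← integral_const_mul, ← integral_sub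
          (integrable_rieszKernel_mul _ (hg.mul_left hcoord) hy)
          ((integrable_rieszKernel_mul _ hg hy).const_mul _)]
        congr 1; ext x; ring
      rw [h3, h4] at e
      have h5 : rieszPotential (2 * (m + 1 : ℕ)) g' y =
          -(rieszPotential (2 * m) (fun x => x i * g x) y -
            y i * rieszPotential (2 * m) g y) := by
        rw [hg', rieszPotential_const_mul, e]
        push_cast
        field_simp
      simp only [hgh hy, h5]
      ring
    convert (evenPotentials d).add_mem h1 h2 using 1
    ext y; simp

theorem const_mem_evenPotentials (hd : 1 ≤ d) (c : ℝ) :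
    (fun _ => c) ∈ evenPotentials d := by
  set x₀ : EuclideanSpace ℝ (Fin d) := EuclideanSpace.single ⟨0, hd⟩ (7 / 2) with hx₀
  let φ : ContDiffBump x₀ := ⟨1 / 8, 1 / 4, by norm_num, by norm_num⟩
  have hφ : IsTestFunctionOn (shell d) (φ.normed volume) := by
    refine ⟨φ.contDiff_normed, φ.hasCompactSupport_normed, ?_⟩
    rw [φ.tsupport_normed_eq]
    intro x hx
    have h0 : ‖x₀‖ = 7 / 2 := by rw [hx₀, PiLp.norm_single]; norm_num
    have h1 : ‖x - x₀‖ ≤ 1 / 4 := by rwa [mem_closedBall, dist_eq_norm] at hx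
    have h2 : ‖x‖ ≤ ‖x - x₀‖ + ‖x₀‖ := norm_le_norm_sub_add x x₀
    have h3 : ‖x₀‖ ≤ ‖x - x₀‖ + ‖x‖ := by rw [norm_sub_rev]; exact norm_le_norm_sub_add x₀ x
    constructor
    · simp; linarith
    · simp; linarith
  have h1 : (fun _ => (1 : ℝ)) ∈ evenPotentials d := by
    refine Submodule.subset_span ⟨0, _, hφ, fun y _ => ?_⟩
    simp [rieszPotential, rieszKernel, φ.integral_normed]
  convert (evenPotentials d).smul_mem c h1 using 1
  ext; simp

/-- Convolutions with polynomial kernels are polynomials. -/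
theorem integral_pow_mem_evenPotentials (hd : 1 ≤ d) (a b : ℝ) (N : ℕ) :
    ∀ F : EuclideanSpace ℝ (Fin d) → ℝ, Continuous F → HasCompactSupport F →
      (fun y => ∫ x, (a + b * ‖y - x‖ ^ 2) ^ N * F x) ∈ evenPotentials d := by
  induction N with
  | zero => intro F _ _; simpa using const_mem_evenPotentials hd _
  | succ N ih =>
    intro F hF hFs
    have hint (G : EuclideanSpace ℝ (Fin d) → ℝ) (hG : Continuous G) (hGs : HasCompactSupport G)
        (y : EuclideanSpace ℝ (Fin d)) :
        Integrable (fun x => (a + b * ‖y - x‖ ^ 2) ^ N * G x) :=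
      (((continuous_const.add (continuous_const.mul
        ((continuous_const.sub continuous_id).norm.pow 2))).pow N).mul hG).integrable_of_hasCompactSupport hGs.mul_left
    have hF₁ : Continuous fun x => (a + b * ‖x‖ ^ 2) * F x :=
      (continuous_const.add (continuous_const.mul (continuous_norm.pow 2))).mul hF
    have hF₁s : HasCompactSupport fun x => (a + b * ‖x‖ ^ 2) * F x := hFs.mul_left
    have hF₂ (i : Fin d) : Continuous fun x => x i * F x :=
      (EuclideanSpace.proj i : EuclideanSpace ℝ (Fin d) →L[ℝ] ℝ).continuous.mul hF
    have hF₂s (i : Fin d) : HasCompactSupport fun x => x i * F x := hFs.mul_left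
    have h0 := ih F hF hFs
    have h1 := ih _ hF₁ hF₁s
    have h2 (i : Fin d) := ih _ (hF₂ i) (hF₂s i)
    -- `a + b |y - x|² = (a + b |x|²) + b |y|² - 2 b ∑ yᵢ xᵢ`
    convert (evenPotentials d).add_mem h1 ((evenPotentials d).smul_mem b
      ((evenPotentials d).sum_mem fun i (_ : i ∈ Finset.univ) => (evenPotentials d).sub_mem
        (coord_mul_mem_evenPotentials i (coord_mul_mem_evenPotentials i h0))
        ((evenPotentials d).smul_mem 2 (coord_mul_mem_evenPotentials i (h2 i))))) using 1
    ext y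
    simp only [Pi.add_apply, Pi.smul_apply, Finset.sum_apply, Pi.sub_apply, smul_eq_mul]
    simp only [← integral_const_mul]
    have hi (i : Fin d) := ((hint F hF hFs y).const_mul (y i)).const_mul (y i)
    have hi' (i : Fin d) := ((hint _ (hF₂ i) (hF₂s i) y).const_mul
      (y i)).const_mul 2
    have hsub (i : Fin d) : Integrable fun x =>
        y i * (y i * ((a + b * ‖y - x‖ ^ 2) ^ N * F x)) -
          2 * (y i * ((a + b * ‖y - x‖ ^ 2) ^ N * (x i * F x))) := (hi i).sub (hi' i)
    rw [Finset.sum_congr rfl fun i _ => (integral_sub (hi i) (hi' i)).symm,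
      ← integral_finsetSum _ fun i _ => hsub i, ← integral_const_mul,
      ← integral_add (hint _ hF₁ hF₁s y)
        ((integrable_finsetSum _ fun i _ => hsub i).const_mul b)]
    congr 1
    ext x
    have e : ‖y - x‖ ^ 2 = ‖x‖ ^ 2 + ∑ i, (y i * y i - 2 * (y i * x i)) := by
      simp only [EuclideanSpace.real_norm_sq_eq, ← Finset.sum_add_distrib, PiLp.sub_apply]
      exact Finset.sum_congr rfl fun i _ => by ring
    rw [pow_succ]
    nth_rw 2 [e]
    simp only [mul_add, add_mul, Finset.mul_sum, Finset.sum_mul, add_assoc]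
    congr 1
    · ring
    · congr 1
      · ring
      · exact Finset.sum_congr rfl fun i _ => by ring

end Polynomials

/-! ### Weierstrass approximation in `C^k` of the ball -/

section Weierstrass

variable {d k : ℕ}

/-- The Landau kernels, the normalized powers of `1 - |z|² / 9` on the ball of radius `3`, form an
approximate identity. The uniformity in `y` comes from letting the peak integral take its values in
the space of continuous functions on the closed unit ball. -/
theorem eventually_landau_near {V : Type*} [NormedAddCommGroup V] [NormedSpace ℝ V] [CompleteSpace V]
    {D : EuclideanSpace ℝ (Fin d) → V} (hD : Continuous D) {δ : ℝ} (hδ : 0 < δ) :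
    ∀ᶠ N : ℕ in atTop, ∀ y ∈ closedBall (0 : EuclideanSpace ℝ (Fin d)) 1,
      ‖(∫ z in closedBall (0 : EuclideanSpace ℝ (Fin d)) 3, (1 + (-1 / 9) * ‖z‖ ^ 2) ^ N)⁻¹ •
        (∫ z in closedBall (0 : EuclideanSpace ℝ (Fin d)) 3,
          (1 + (-1 / 9) * ‖z‖ ^ 2) ^ N • D (y - z)) - D y‖ < δ := by
  let E := EuclideanSpace ℝ (Fin d)
  let B : Set E := closedBall 0 1
  have : CompactSpace B := isCompact_iff_compactSpace.1 (isCompact_closedBall _ _)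
  let c : E → ℝ := fun z => 1 + (-1 / 9) * ‖z‖ ^ 2
  have hc : Continuous c := continuous_const.add (continuous_const.mul (continuous_norm.pow 2))
  let G : C(E, C(B, V)) := ContinuousMap.curry
    ⟨fun p : E × B => D (p.2 - p.1), hD.comp (by fun_prop)⟩
  have hpeak : Tendsto (fun N : ℕ => (∫ z in closedBall (0 : E) 3, c z ^ N)⁻¹ •
      ∫ z in closedBall (0 : E) 3, c z ^ N • G z) atTop (𝓝 (G 0)) := by
    refine tendsto_setIntegral_pow_smul_of_unique_maximum_of_isCompact_of_continuousOn
      (isCompact_closedBall _ _) hc.continuousOn ?_ ?_ ?_ ?_ G.continuous.continuousOn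
    · intro z _ hz
      have : 0 < ‖z‖ := norm_pos_iff.2 hz
      simp only [c, norm_zero]
      nlinarith
    · intro z hz
      have : ‖z‖ ≤ 3 := by simpa using hz
      simp only [c]
      nlinarith [norm_nonneg z]
    · simp [c]
    · exact subset_closure (ball_subset_interior_closedBall (by simp))
  filter_upwards [Metric.tendsto_nhds.1 hpeak δ hδ] with N hN y hy
  have h1 := (ContinuousMap.dist_apply_le_dist ⟨y, hy⟩).trans_lt hN
  have hint : IntegrableOn (fun z => c z ^ N • G z) (closedBall (0 : E) 3) :=
    ((hc.pow N).smul G.continuous).continuousOn.integrableOn_compact (isCompact_closedBall _ _)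
  have h2 : ∫ z in closedBall (0 : E) 3, c z ^ N • D (y - z) =
      (∫ z in closedBall (0 : E) 3, c z ^ N • G z) ⟨y, hy⟩ :=
    (ContinuousMap.evalCLM ℝ (⟨y, hy⟩ : B)).integral_comp_comm hint
  rw [ContinuousMap.smul_apply, ← h2, dist_eq_norm] at h1
  simpa [G] using h1

/-- Weierstrass approximation in `C^k`: the convolutions of `F` with the Landau kernels are
polynomials, and their derivatives are the convolutions of the derivatives of `F`. -/
theorem exists_evenPotentials_near (hd : 1 ≤ d) {F : EuclideanSpace ℝ (Fin d) → ℝ}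
    (hF : ContDiff ℝ k F) (hF2 : tsupport F ⊆ closedBall 0 2) {δ : ℝ} (hδ : 0 < δ) :
    ∃ h ∈ evenPotentials d, ∀ j ≤ k, ∀ y ∈ closedBall (0 : EuclideanSpace ℝ (Fin d)) 1,
      ‖iteratedFDeriv ℝ j F y - iteratedFDerivWithin ℝ j h (closedBall 0 1) y‖ ≤ δ := by
  have hFs : HasCompactSupport F :=
    (isCompact_closedBall _ _).of_isClosed_subset (isClosed_tsupport F) hF2
  let E := EuclideanSpace ℝ (Fin d)
  have hev : ∀ᶠ N : ℕ in atTop, ∀ j ∈ Finset.range (k + 1), ∀ y ∈ closedBall (0 : E) 1,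
      ‖(∫ z in closedBall (0 : E) 3, (1 + (-1 / 9) * ‖z‖ ^ 2) ^ N)⁻¹ •
        (∫ z in closedBall (0 : E) 3,
          (1 + (-1 / 9) * ‖z‖ ^ 2) ^ N • iteratedFDeriv ℝ j F (y - z)) -
            iteratedFDeriv ℝ j F y‖ < δ := by
    rw [Filter.eventually_all_finset]
    intro j hj
    have hj' : j ≤ k := by simpa [Nat.lt_succ_iff] using hj
    exact eventually_landau_near (hF.continuous_iteratedFDeriv (by exact_mod_cast hj')) hδ
  obtain ⟨N, hN⟩ := hev.exists
  set K := (∫ z in closedBall (0 : E) 3, (1 + (-1 / 9) * ‖z‖ ^ 2) ^ N)⁻¹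
  let c : E → ℝ := fun z => (1 + (-1 / 9) * ‖z‖ ^ 2) ^ N
  have hc : LocallyIntegrable c := ((continuous_const.add
    (continuous_const.mul (continuous_norm.pow 2))).pow N).locallyIntegrable
  refine ⟨K • fun y => ∫ x, c (y - x) * F x, (evenPotentials d).smul_mem K
    (integral_pow_mem_evenPotentials hd 1 (-1 / 9) N F hF.continuous hFs), fun j hj y hy => ?_⟩
  have hconv : (fun y => ∫ x, c (y - x) * F x) = c ⋆[lsmul ℝ ℝ] F := by
    ext y
    rw [convolution_lsmul_swap]
    rfl
  have hsm : ContDiff ℝ k (c ⋆[lsmul ℝ ℝ] F) := contDiff_convolution_lsmul hc hFs hF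
  rw [hconv, iteratedFDerivWithin_const_smul_apply
    ((hsm.of_le (by exact_mod_cast hj)).contDiffWithinAt) uniqueDiffOn_closedBall_one hy,
    iteratedFDerivWithin_closedBall_eq hsm hj hy, iteratedFDeriv_convolution_lsmul hc hFs hF hj,
    convolution_lsmul, norm_sub_rev]
  have h2 : ∫ z in closedBall (0 : E) 3, c z • iteratedFDeriv ℝ j F (y - z) =
      ∫ z, c z • iteratedFDeriv ℝ j F (y - z) := by
    refine setIntegral_eq_integral_of_forall_compl_eq_zero fun z hz => ?_
    -- For `|y| ≤ 1` and `|z| > 3` the point `y - z` is outside the support of `F`.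
    have hz3 : 3 < ‖z‖ := by simpa using hz
    have hy1 : ‖y‖ ≤ 1 := by simpa using hy
    have hyz : y - z ∉ tsupport (iteratedFDeriv ℝ j F) := fun hmem => by
      have : ‖y - z‖ ≤ 2 := by simpa using hF2 (tsupport_iteratedFDeriv_subset j hmem)
      linarith [norm_sub_norm_le z y, norm_sub_rev z y]
    rw [image_eq_zero_of_notMem_tsupport hyz, smul_zero]
  rw [← h2]
  exact (hN j (Finset.mem_range.2 (by omega)) y hy).le

/-- A `C^k` function on the closed unit ball is approximated by the dilations `y ↦ f (r y)` with
`r < 1`, which a cutoff extends to the whole space. -/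
theorem exists_contDiff_near {f : EuclideanSpace ℝ (Fin d) → ℝ}
    (hf : ContDiffOn ℝ k f (closedBall 0 1)) {δ : ℝ} (hδ : 0 < δ) :
    ∃ F : EuclideanSpace ℝ (Fin d) → ℝ, ContDiff ℝ k F ∧ tsupport F ⊆ closedBall 0 2 ∧
      ∀ j ≤ k, ∀ y ∈ closedBall (0 : EuclideanSpace ℝ (Fin d)) 1,
        ‖iteratedFDerivWithin ℝ j f (closedBall 0 1) y - iteratedFDeriv ℝ j F y‖ ≤ δ := by
  let E := EuclideanSpace ℝ (Fin d)
  let B : Set E := closedBall 0 1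
  have hsmul (r : ℝ) (hr : r ∈ Icc (0 : ℝ) 1) (y : E) (hy : y ∈ B) : r • y ∈ B := by
    have hy1 : ‖y‖ ≤ 1 := by simpa [B] using hy
    have : ‖r • y‖ ≤ 1 := by
      rw [norm_smul, Real.norm_eq_abs, abs_of_nonneg hr.1]
      exact mul_le_one₀ hr.2 (norm_nonneg _) hy1
    simpa [B] using this
  have hunif (j : ℕ) (hj : j ≤ k) : ∀ᶠ r : ℝ in 𝓝[<] 1, ∀ y ∈ B,
      ‖iteratedFDerivWithin ℝ j f B y - r ^ j • iteratedFDerivWithin ℝ j f B (r • y)‖ ≤ δ := by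
    have hcont : ContinuousOn (fun p : ℝ × E => p.1 ^ j • iteratedFDerivWithin ℝ j f B (p.1 • p.2))
        (Icc 0 1 ×ˢ B) := by
      refine (continuous_fst.pow j).continuousOn.smul
        ((hf.continuousOn_iteratedFDerivWithin (by exact_mod_cast hj)
          uniqueDiffOn_closedBall_one).comp (continuous_fst.smul continuous_snd).continuousOn ?_)
      exact fun p hp => hsmul _ hp.1 _ hp.2
    obtain ⟨η, hη, H⟩ := Metric.uniformContinuousOn_iff.1
      ((isCompact_Icc.prod (isCompact_closedBall (0 : E) 1)).uniformContinuousOn_of_continuous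
        hcont) δ hδ
    have hmem : Ioo (max 0 (1 - η)) 1 ∈ 𝓝[<] (1 : ℝ) :=
      Ioo_mem_nhdsLT (max_lt one_pos (by linarith))
    filter_upwards [hmem] with r hr y hy
    have hr0 : 0 < r := (le_max_left _ _).trans_lt hr.1
    have hr1 : 1 - η < r := (le_max_right _ _).trans_lt hr.1
    have := H (1, y) ⟨by simp, hy⟩ (r, y) ⟨⟨hr0.le, hr.2.le⟩, hy⟩ (by
      rw [Prod.dist_eq, dist_self, max_eq_left dist_nonneg, Real.dist_eq, abs_of_pos] <;>
      linarith [hr.2])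
    rw [dist_eq_norm] at this
    simpa using this.le
  have hev : ∀ᶠ r : ℝ in 𝓝[<] 1, r ∈ Ioo (1 / 2 : ℝ) 1 ∧ ∀ j ∈ Finset.range (k + 1), ∀ y ∈ B,
      ‖iteratedFDerivWithin ℝ j f B y - r ^ j • iteratedFDerivWithin ℝ j f B (r • y)‖ ≤ δ := by
    have hIoo : ∀ᶠ r : ℝ in 𝓝[<] 1, r ∈ Ioo (1 / 2 : ℝ) 1 := Ioo_mem_nhdsLT (by norm_num)
    refine hIoo.and ?_
    rw [Filter.eventually_all_finset]
    exact fun j hj => hunif j (by simpa [Nat.lt_succ_iff] using hj)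
  obtain ⟨r, hr, hrδ⟩ := hev.exists
  have hr0 : 0 < r := by linarith [hr.1]
  have hR1 : 1 < 1 / r := by rw [lt_div_iff₀ hr0]; linarith [hr.2]
  have hR2 : 1 / r < 2 := by rw [div_lt_iff₀ hr0]; linarith [hr.1]
  -- The dilated function is defined for `|y| < 1 / r`; the radii satisfy `1 < rIn < rOut < 1 / r`.
  let χ : ContDiffBump (0 : E) :=
    ⟨(2 + 1 / r) / 3, (1 + 2 * (1 / r)) / 3, by linarith, by linarith⟩
  let g : E →L[ℝ] E := r • ContinuousLinearMap.id ℝ E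
  have hg (y : E) : g y = r • y := rfl
  have hgB (y : E) (hy : ‖y‖ < 1 / r) : g ⁻¹' B ∈ 𝓝 y := by
    refine g.continuous.continuousAt.preimage_mem_nhds
      (mem_of_superset (isOpen_ball.mem_nhds ?_) ball_subset_closedBall)
    rw [mem_ball_zero_iff, hg, norm_smul, Real.norm_eq_abs, abs_of_pos hr0]
    rwa [lt_div_iff₀' hr0] at hy
  have hcomp (y : E) (hy : ‖y‖ < 1 / r) : ContDiffAt ℝ k (f ∘ g) y :=
    (hf.comp g.contDiff.contDiffOn (fun _ h => h)).contDiffAt (hgB y hy)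
  have hsupp : tsupport (fun y => χ y * (f ∘ g) y) ⊆ closedBall 0 ((1 + 2 * (1 / r)) / 3) :=
    (tsupport_mul_subset_left).trans_eq χ.tsupport_eq
  refine ⟨fun y => χ y * (f ∘ g) y, contDiff_iff_contDiffAt.2 fun y => ?_,
    hsupp.trans (closedBall_subset_closedBall (by linarith)), fun j hj y hy => ?_⟩
  · by_cases hy : y ∈ tsupport fun y => χ y * (f ∘ g) y
    · have : ‖y‖ ≤ (1 + 2 * (1 / r)) / 3 := by simpa using hsupp hy
      exact χ.contDiff.contDiffAt.mul (hcomp y (by linarith))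
    · exact contDiffAt_const.congr_of_eventuallyEq (notMem_tsupport_iff_eventuallyEq.1 hy)
  · have hy1 : ‖y‖ ≤ 1 := by simpa using hy
    have hloc : (fun y => χ y * (f ∘ g) y) =ᶠ[𝓝 y] f ∘ g := by
      have : closedBall (0 : E) ((2 + 1 / r) / 3) ∈ 𝓝 y :=
        mem_of_superset (isOpen_ball.mem_nhds (by rw [mem_ball_zero_iff]; linarith))
          ball_subset_closedBall
      filter_upwards [this] with z hz
      rw [χ.one_of_mem_closedBall hz, one_mul]
    have hgu : UniqueDiffOn ℝ (g ⁻¹' B) := by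
      refine uniqueDiffOn_convex ((convex_closedBall 0 1).linear_preimage g.toLinearMap) ?_
      exact ⟨0, mem_interior_iff_mem_nhds.2 (hgB 0 (by rw [norm_zero]; positivity))⟩
    have hgy : g y ∈ B := hsmul r ⟨hr0.le, hr.2.le⟩ y hy
    rw [hloc.iteratedFDeriv ℝ j |>.eq_of_nhds,
      ← iteratedFDerivWithin_eq_iteratedFDeriv hgu
        ((hcomp y (by linarith)).of_le (by exact_mod_cast hj)) hgy,
      g.iteratedFDerivWithin_comp_right hf uniqueDiffOn_closedBall_one hgu hgy
        (by exact_mod_cast hj)]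
    have e : (iteratedFDerivWithin ℝ j f B (g y)).compContinuousLinearMap (fun _ => g) =
        r ^ j • iteratedFDerivWithin ℝ j f B (r • y) := by
      ext v
      simp only [ContinuousMultilinearMap.compContinuousLinearMap_apply, hg, smul_apply]
      rw [ContinuousMultilinearMap.map_smul_univ]
      simp
    rw [e]
    exact hrδ j (Finset.mem_range.2 (by omega)) y hy

end Weierstrass

/-! ### Density -/

section Conclusion

variable {d k : ℕ}

theorem contDiffOn_mem_ckClosure (hd : 1 ≤ d) {n : ℝ}
    (hn : ∀ m : ℕ, n + (d : ℝ) ≠ 2 * ((m : ℝ) + 1)) (hn_even : ∀ m : ℕ, n ≠ 2 * (m : ℝ))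
    {f : EuclideanSpace ℝ (Fin d) → ℝ} (hf : ContDiffOn ℝ k f (closedBall 0 1)) :
    f ∈ ckClosure d n k := by
  refine mem_ckClosure_of_forall_exists hf fun δ hδ => ?_
  obtain ⟨F, hF, hF2, hFf⟩ := exists_contDiff_near hf (half_pos hδ)
  obtain ⟨h, hh, hhF⟩ := exists_evenPotentials_near hd hF hF2 (half_pos hδ)
  refine ⟨h, evenPotentials_subset_ckClosure hn hn_even k hh, fun j hj y hy => ?_⟩
  rw [← sub_add_sub_cancel]
  exact (norm_add_le _ _).trans (by linarith [hFf j hj y hy, hhF j hj y hy])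

/-- The operator norm of the `j`-th derivative bounds every partial derivative of order `j`. -/
theorem ckNorm_le {f : EuclideanSpace ℝ (Fin d) → ℝ} {δ : ℝ}
    (h : ∀ j ≤ k, ∀ y ∈ closedBall (0 : EuclideanSpace ℝ (Fin d)) 1,
      ‖iteratedFDerivWithin ℝ j f (closedBall 0 1) y‖ ≤ δ) :
    ckNorm d k f ≤ (∑ j ∈ Finset.range (k + 1), Fintype.card (Fin j → Fin d) : ℕ) * δ := by
  have : Nonempty (closedBall (0 : EuclideanSpace ℝ (Fin d)) 1) := ⟨0, by simp⟩
  have hδ : 0 ≤ δ := (norm_nonneg _).trans (h 0 (Nat.zero_le _) 0 (by simp))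
  rw [ckNorm, Nat.cast_sum, Finset.sum_mul]
  refine Finset.sum_le_sum fun j hj => ?_
  have hjk : j ≤ k := by simpa [Nat.lt_succ_iff] using hj
  have hle (ι : Fin j → Fin d) :
      ⨆ y : closedBall (0 : EuclideanSpace ℝ (Fin d)) 1, |partialDerivBall ι f y| ≤ δ := by
    refine ciSup_le fun y => ?_
    have := ContinuousMultilinearMap.le_opNorm
      (iteratedFDerivWithin ℝ j f (closedBall 0 1) (y : EuclideanSpace ℝ (Fin d)))
      (fun i => EuclideanSpace.single (ι i) (1 : ℝ))
    refine this.trans ?_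
    simpa using h j hjk y y.2
  refine (Finset.sum_le_sum fun ι _ => hle ι).trans ?_
  rw [Finset.sum_const, nsmul_eq_mul]
  gcongr
  exact Finset.card_le_univ _

end Conclusion

theorem theorem2p1 (d : ℕ) (hd : 1 ≤ d) (n : ℝ)
    (hn : ∀ m : ℕ, n + (d : ℝ) ≠ 2 * ((m : ℝ) + 1))
    (hn_even : ∀ m : ℕ, n ≠ 2 * (m : ℝ)) (k : ℕ) :
    IsDenseInCk d k (shellPotentials d n) ∧
      (-(d : ℝ) < n → n < 0 →
        ∀ g : EuclideanSpace ℝ (Fin d) → ℝ, IsTestFunctionOn (shell d) g →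
          (∀ y, Integrable (fun x => rieszKernel n x y * g x)) ∧
          ContDiff ℝ ∞ (rieszPotential n g) ∧
          ∀ j : ℕ,
            (∃ C : ℝ, ∀ y, ‖iteratedFDeriv ℝ j (rieszPotential n g) y‖ ≤ C) ∧
            Tendsto (iteratedFDeriv ℝ j (rieszPotential n g))
              (cocompact (EuclideanSpace ℝ (Fin d))) (𝓝 0)) := by
  refine ⟨⟨?_, fun f hf ε hε => ?_⟩, fun hn1 hn0 g hg => rieszPotential_decay hd hn1 hn0 hg.1 hg.2.1⟩
  · rintro h ⟨g, hg, hgh⟩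
    exact (contDiffOn_rieszPotential_nat n k hg).congr hgh
  · set A : ℕ := ∑ j ∈ Finset.range (k + 1), Fintype.card (Fin j → Fin d)
    obtain ⟨g, hg, hgf⟩ := (contDiffOn_mem_ckClosure hd hn hn_even hf).2 (ε / (A + 1))
      (by positivity)
    refine ⟨rieszPotential n g, ⟨g, hg, fun _ _ => rfl⟩, ?_⟩
    refine (ckNorm_le (δ := ε / (A + 1)) fun j hj y hy => ?_).trans_lt ?_
    · have e := iteratedFDerivWithin_sub_apply
        ((hf.of_le (by exact_mod_cast hj : (j : WithTop ℕ∞) ≤ k)) y hy)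
        ((contDiffOn_rieszPotential_nat n j hg) y hy) uniqueDiffOn_closedBall_one hy
      refine le_of_eq_of_le (congrArg norm e) (hgf j hj y hy)
    · rw [mul_div_assoc', div_lt_iff₀ (by positivity)]
      nlinarith
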